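/- Let $X_1,X_2,\dots$ be independent random vectors on a probability space with $\mathbb P(X_j=e)=\tfrac14$ for each $e\in\{\pm(1,0),\pm(0,1)\}$, and let $S(0)=(0,0)$, $S(k)=\sum_{j=1}^k X_j$ be planar simple random walk. Extend $S$ to real times $t\ge 0$ by linear interpolation, $S(t)=S([t])+(t-[t])\,(S([t]+1)-S([t]))$, where $[t]$ is the integer part of $t$, and let $S[0,2n]=\{S(t):0\le t\le 2n\}\subset\mathbb C$. The holes made by $S[0,2n]$ are the connected components of $\mathbb C\setminus S[0,2n]$ (the unbounded one included), and the area of a hole is its Lebesgue measure. The lattice holes made by $S[0,2n]$ are the connected components, with respect to nearest-neighbour paths, of $\mathbb Z^2\setminus\{S(0),S(1),\dots,S(2n)\}$, and the lattice area of a lattice hole is its cardinality. Let $\mathcal H_n(1)$ be the number of holes of area $\ge 1$ and $\mathcal L_n(1)$ the number of lattice holes of lattice area $\ge 1$ made by $S[0,2n]$. Then $$\lim_{n\to\infty}\frac{\log\mathbb E[\mathcal H_n(1)]}{\log n}=1\qquad\text{and}\qquad\lim_{n\to\infty}\frac{\log\mathbb E[\mathcal L_n(1)]}{\log n}=1 .$$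 -/

import Mathlib

open MeasureTheory ProbabilityTheory Filter Asymptotics
open scoped NNReal ENNReal

namespace PlanarWalk

/-- `X 0, X 1, X 2, …` are the steps of planar simple random walk: independent random vectors in
`ℤ²`, each of which is `e₁`, `-e₁`, `e₂`, `-e₂` with probability `1 / 4` each. -/
structure IsSimpleRandomSteps {Ω : Type*} [MeasurableSpace Ω] (P : Measure Ω)
    (X : ℕ → Ω → ℤ × ℤ) : Prop where
  measurable : ∀ j, Measurable (X j)
  indep : iIndepFun X P
  law : ∀ j, ∀ e ∈ ({(1, 0), (-1, 0), (0, 1), (0, -1)} : Set (ℤ × ℤ)),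
    P {ω | X j ω = e} = 1 / 4

/-- The walk with steps `X 0, X 1, …`, started at the origin: the position at time `k` is the sum
of the first `k` steps. -/
def walk {Ω : Type*} (X : ℕ → Ω → ℤ × ℤ) (ω : Ω) (k : ℕ) : ℤ × ℤ :=
  ∑ j ∈ Finset.range k, X j ω

/-- A lattice point as a point of the complex plane. -/
def toPlane (z : ℤ × ℤ) : ℂ := ⟨(z.1 : ℝ), (z.2 : ℝ)⟩

/-- The linear interpolation `s(t) = s([t]) + (t - [t]) (s([t] + 1) - s([t]))`, for real `t ≥ 0`,
of a lattice path `s`. -/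
noncomputable def interp (s : ℕ → ℤ × ℤ) (t : ℝ) : ℂ :=
  toPlane (s ⌊t⌋₊) + ((t - (⌊t⌋₊ : ℝ) : ℝ) : ℂ) * (toPlane (s (⌊t⌋₊ + 1)) - toPlane (s ⌊t⌋₊))

/-- The trace `s[a, b]` of the interpolated path. -/
def trace (s : ℕ → ℤ × ℤ) (a b : ℝ) : Set ℂ := interp s '' Set.Icc a b

/-- The holes made by `s[0, 2n]`: the connected components of `ℂ \ s[0, 2n]`. -/
def holes (s : ℕ → ℤ × ℤ) (n : ℕ) : Set (Set ℂ) :=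
  {C | ∃ z ∈ (trace s 0 (2 * n))ᶜ, C = connectedComponentIn (trace s 0 (2 * n))ᶜ z}

/-- The number of holes of area (Lebesgue measure) at least `r` made by `s[0, 2n]`. -/
noncomputable def holeCount (s : ℕ → ℤ × ℤ) (n : ℕ) (r : ℝ≥0) : ℕ∞ :=
  {C ∈ holes s n | (r : ℝ≥0∞) ≤ volume C}.encard

/-- The nearest-neighbour graph on `ℤ²`. -/
def latticeGraph : SimpleGraph (ℤ × ℤ) where
  Adj z w := |z.1 - w.1| + |z.2 - w.2| = 1
  symm := ⟨fun z w h => by rwa [abs_sub_comm w.1, abs_sub_comm w.2]⟩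
  loopless := ⟨fun z h => by simp at h⟩

/-- The lattice points not visited by `s` up to time `2n`. -/
def unvisited (s : ℕ → ℤ × ℤ) (n : ℕ) : Set (ℤ × ℤ) := {z | ∀ j ≤ 2 * n, s j ≠ z}

/-- The lattice holes made by `s[0, 2n]`: the connected components of the graph that the
nearest-neighbour graph induces on the unvisited lattice points. -/
abbrev LatticeHole (s : ℕ → ℤ × ℤ) (n : ℕ) : Type :=
  (latticeGraph.induce (unvisited s n)).ConnectedComponent

/-- The number of lattice holes of lattice area (cardinality) at least `r` made by `s[0, 2n]`. -/
noncomputable def latticeHoleCount (s : ℕ → ℤ × ℤ) (n : ℕ) (r : ℝ≥0) : ℕ∞ :=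
  {C : LatticeHole s n | (r : ℝ≥0∞) ≤ (C.supp.encard : ℝ≥0∞)}.encard

/-- The expected number of holes of area at least `r` made by the walk up to time `2n`. -/
noncomputable def expectedHoles {Ω : Type*} [MeasurableSpace Ω] (P : Measure Ω)
    (X : ℕ → Ω → ℤ × ℤ) (n : ℕ) (r : ℝ≥0) : ℝ≥0∞ :=
  ∫⁻ ω, (holeCount (walk X ω) n r : ℝ≥0∞) ∂P

/-- The expected number of lattice holes of lattice area at least `r` made by the walk up to
time `2n`. -/
noncomputable def expectedLatticeHoles {Ω : Type*} [MeasurableSpace Ω] (P : Measure Ω)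
    (X : ℕ → Ω → ℤ × ℤ) (n : ℕ) (r : ℝ≥0) : ℝ≥0∞ :=
  ∫⁻ ω, (latticeHoleCount (walk X ω) n r : ℝ≥0∞) ∂P

/-! The two counts depend only on the path up to time `2n`, so they are random variables. -/

theorem trace_congr {s s' : ℕ → ℤ × ℤ} {n : ℕ} (h : ∀ k < 2 * n + 2, s k = s' k) :
    trace s 0 (2 * n) = trace s' 0 (2 * n) := by
  refine Set.image_congr fun t ht => ?_
  have hk : ⌊t⌋₊ ≤ 2 * n := Nat.floor_le_of_le (by exact_mod_cast ht.2)
  simp only [interp, h ⌊t⌋₊ (by omega), h (⌊t⌋₊ + 1) (by omega)]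

theorem measurable_of_finite_dep {Ω β : Type*} [MeasurableSpace Ω] [MeasurableSpace β]
    {X : ℕ → Ω → ℤ × ℤ} (hX : ∀ j, Measurable (X j)) (m : ℕ) (F : (ℕ → ℤ × ℤ) → β)
    (hF : ∀ s s' : ℕ → ℤ × ℤ, (∀ k < m, s k = s' k) → F s = F s') :
    Measurable fun ω => F (walk X ω) := by
  have hw : ∀ k, Measurable fun ω => walk X ω k := fun k =>
    Finset.measurable_sum _ fun j _ => hX j
  have h1 : Measurable fun ω => fun i : Fin m => walk X ω i := measurable_pi_lambda _ fun i => hw i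
  have h2 : Measurable fun v : Fin m → ℤ × ℤ =>
      F fun k => if hk : k < m then v ⟨k, hk⟩ else 0 := measurable_of_countable _
  convert h2.comp h1 using 1
  funext ω
  exact hF _ _ fun k hk => by simp [hk]

theorem measurable_holeCount {Ω : Type*} [MeasurableSpace Ω]
    {X : ℕ → Ω → ℤ × ℤ} (hX : ∀ j, Measurable (X j)) (n : ℕ) (r : ℝ≥0) :
    Measurable fun ω => (holeCount (walk X ω) n r : ℝ≥0∞) :=
  measurable_of_finite_dep hX (2 * n + 2) (fun s => (holeCount s n r : ℝ≥0∞)) fun s s' h => by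
    simp only [holeCount, holes, trace_congr h]

theorem measurable_latticeHoleCount {Ω : Type*} [MeasurableSpace Ω]
    {X : ℕ → Ω → ℤ × ℤ} (hX : ∀ j, Measurable (X j)) (n : ℕ) (r : ℝ≥0) :
    Measurable fun ω => (latticeHoleCount (walk X ω) n r : ℝ≥0∞) :=
  measurable_of_finite_dep hX (2 * n + 2) (fun s => (latticeHoleCount s n r : ℝ≥0∞))
    fun s s' h => by
      have hu : unvisited s n = unvisited s' n := by
        ext z
        exact forall₂_congr fun j hj => by rw [h j (by omega)]
      exact congrArg (fun U : Set (ℤ × ℤ) =>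
        ({C : (latticeGraph.induce U).ConnectedComponent |
          (r : ℝ≥0∞) ≤ (C.supp.encard : ℝ≥0∞)}.encard : ℝ≥0∞)) hu

end PlanarWalk

/-!
Both expectations lie between a constant times `n / (log n) ^ 2` and a constant times `n`.

The upper bounds are deterministic. A lattice hole contains a neighbour of a visited point, and a
hole contains a face of the grid within bounded distance of a visited point, because its frontier is
contained in the trace; so there are `O(n)` of either kind (`latticeHoleCount_le`, `holeCount_le`).

For the lower bounds one configuration serves both counts. If the walk runs through the eight edges
around a point `z` which it never visits, then `{z}` is a lattice hole and the open square of side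
length `2` around `z` is a hole (`encard_isRingCentre_le_latticeHoleCount`,
`encard_isRingCentre_le_holeCount`). At a given time such a ring is started with probability `4⁻⁸`;
independently the walk before, run backwards, and the walk after keep away from the centre of the
ring, and from their own starting point, each with probability at least of order `1 / log n`
(`IsSimpleRandomSteps.le_measure_isRing`). Since the start of the ring is not visited afterwards,
rings that start at different times have different centres (`card_isRing_le`), and summation over
the starting times gives the bound.

The escape probability `ρ N` from a pair of points is bounded below by `le_escape_pair`. Decomposing
according to the last visit to the pair up to time `5 N` (`last_exit`) writes `1` as a sum over `k`
of the probability of being in the pair at time `k`, multiplied by the probability of escaping for the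
remaining time, which is the same from both points by reflection. Transition probabilities at
time `k` are at most `1 / (k + 1)` (`nbrAvg_iterate_single_le`), since rotation by `π / 4` splits
the walk into two independent walks on `ℤ`. Hence the times after `4 N` contribute at most `1 / 2`, and
the others at most `2 * ρ N * (1 + log (4 N + 1))`.
-/

namespace PlanarWalk

/-! ### The transition operator and escape probabilities -/

/-- The transition operator of planar simple random walk: the mean over the four neighbours. -/
noncomputable def nbrAvg (f : ℤ × ℤ → ℝ) (x : ℤ × ℤ) : ℝ :=
  (f (x + (1, 0)) + f (x + (-1, 0)) + f (x + (0, 1)) + f (x + (0, -1))) / 4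

/-- The probability that the walk started at `x` avoids `A` at the times `1, …, m`. Time `0` is not
looked at, so `x` may lie in `A`. -/
noncomputable def escape (A : Set (ℤ × ℤ)) : ℕ → ℤ × ℤ → ℝ
  | 0, _ => 1
  | m + 1, x => nbrAvg (Aᶜ.indicator (escape A m)) x

theorem nbrAvg_mono {f g : ℤ × ℤ → ℝ} (h : f ≤ g) : nbrAvg f ≤ nbrAvg g := fun x => by
  have h1 := h (x + (1, 0))
  have h2 := h (x + (-1, 0))
  have h3 := h (x + (0, 1))
  have h4 := h (x + (0, -1))
  unfold nbrAvg
  linarith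

theorem nbrAvg_iterate_mono {f g : ℤ × ℤ → ℝ} (h : f ≤ g) (k : ℕ) :
    nbrAvg^[k] f ≤ nbrAvg^[k] g := by
  induction k with
  | zero => exact h
  | succ k ih => simpa only [Function.iterate_succ_apply'] using nbrAvg_mono ih

theorem nbrAvg_iterate_comb (f g : ℤ × ℤ → ℝ) (c : ℝ) (k : ℕ) (x : ℤ × ℤ) :
    nbrAvg^[k] (fun y => c * (f y + g y)) x = c * (nbrAvg^[k] f x + nbrAvg^[k] g x) := by
  induction k generalizing x with
  | zero => rfl
  | succ k ih =>
    simp only [Function.iterate_succ_apply', nbrAvg, ih]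
    ring

theorem nbrAvg_sum (s : Finset ℕ) (F : ℕ → ℤ × ℤ → ℝ) (x : ℤ × ℤ) :
    nbrAvg (fun y => ∑ k ∈ s, F k y) x = ∑ k ∈ s, nbrAvg (F k) x := by
  simp only [nbrAvg, ← Finset.sum_div, Finset.sum_add_distrib]

theorem escape_nonneg (A : Set (ℤ × ℤ)) (m : ℕ) : 0 ≤ escape A m := by
  induction m with
  | zero => exact fun _ => zero_le_one
  | succ m ih =>
    have h := nbrAvg_mono (f := 0) (g := Aᶜ.indicator (escape A m))
      (fun y => Set.indicator_nonneg (fun z _ => ih z) y)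
    intro x
    have h0 : nbrAvg 0 x = 0 := by simp [nbrAvg]
    exact h0.symm.le.trans (h x)

theorem escape_succ_le (A : Set (ℤ × ℤ)) (m : ℕ) : escape A (m + 1) ≤ escape A m := by
  induction m with
  | zero =>
    have h := nbrAvg_mono (f := Aᶜ.indicator (escape A 0)) (g := fun _ => 1)
      (fun y => Set.indicator_le_self' (fun _ _ => zero_le_one) y)
    intro x
    refine (h x).trans ?_
    norm_num [nbrAvg, escape]
  | succ m ih =>
    exact nbrAvg_mono fun y => Set.indicator_le_indicator (ih y)

theorem escape_antitone (A : Set (ℤ × ℤ)) : Antitone (escape A) :=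
  antitone_nat_of_succ_le (escape_succ_le A)

theorem escape_le_one (A : Set (ℤ × ℤ)) (m : ℕ) (x : ℤ × ℤ) : escape A m x ≤ 1 :=
  escape_antitone A (Nat.zero_le m) x

/-- The two points of `{0, d}` are equally good starting points for an escape, by the point
reflection that exchanges them. -/
theorem escape_pair_reflect (d : ℤ × ℤ) (m : ℕ) (x : ℤ × ℤ) :
    escape {0, d} m (d - x) = escape {0, d} m x := by
  have hmem : ∀ y : ℤ × ℤ, d - y ∈ ({0, d} : Set (ℤ × ℤ))ᶜ ↔ y ∈ ({0, d} : Set (ℤ × ℤ))ᶜ := by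
    intro y
    simp only [Set.mem_compl_iff, Set.mem_insert_iff, Set.mem_singleton_iff, sub_eq_zero,
      sub_eq_self, eq_comm (a := d), or_comm]
  induction m generalizing x with
  | zero => rfl
  | succ m ih =>
    have hI : ∀ y, (({0, d} : Set (ℤ × ℤ))ᶜ).indicator (escape {0, d} m) (d - y) =
        (({0, d} : Set (ℤ × ℤ))ᶜ).indicator (escape {0, d} m) y := by
      intro y
      classical
      simp only [Set.indicator_apply, hmem, ih]
    have e : ∀ a b : ℤ, d - x + (a, b) = d - (x + (-a, -b)) := by
      intro a b
      ext <;> simp <;> ring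
    simp only [escape, nbrAvg, e, hI, neg_zero, neg_neg]
    ring

/-- Decomposition according to the last visit to `A` up to time `M`: the summand is the
probability that this visit takes place at time `k`. -/
theorem last_exit (A : Set (ℤ × ℤ)) (M : ℕ) (x : ℤ × ℤ) :
    ∑ k ∈ Finset.range (M + 1), nbrAvg^[k] (A.indicator (escape A (M - k))) x =
      1 - Aᶜ.indicator (escape A M) x := by
  have h1 : ∀ (f : ℤ × ℤ → ℝ) (x : ℤ × ℤ), A.indicator f x = f x - Aᶜ.indicator f x := by
    intro f x
    have := congrFun (Set.indicator_self_add_compl A f) x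
    simp only [Pi.add_apply] at this
    linarith
  induction M generalizing x with
  | zero => simp [h1, escape]
  | succ M ih =>
    rw [Finset.sum_range_succ']
    have : ∀ k, nbrAvg^[k + 1] (A.indicator (escape A (M + 1 - (k + 1)))) x =
        nbrAvg (fun y => nbrAvg^[k] (A.indicator (escape A (M - k))) y) x := by
      intro k
      rw [Function.iterate_succ_apply', Nat.add_sub_add_right]
    simp only [this, ← nbrAvg_sum]
    simp only [ih, Function.iterate_zero, id, h1, Nat.sub_zero]
    simp only [escape, nbrAvg]
    ring

/-! ### The local bound for the transition probabilities -/

/-- The law of simple random walk on `ℤ` started at the origin, at time `k`. -/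
noncomputable def lineLaw : ℕ → ℤ → ℝ
  | 0, u => if u = 0 then 1 else 0
  | k + 1, u => (lineLaw k (u + 1) + lineLaw k (u - 1)) / 2

theorem lineLaw_eq (k : ℕ) (u : ℤ) :
    (∀ i : ℕ, u = 2 * i - k → lineLaw k u = k.choose i / 2 ^ k) ∧
      ((∀ i : ℕ, u ≠ 2 * i - k) → lineLaw k u = 0) := by
  induction k generalizing u with
  | zero =>
    constructor
    · rintro (_ | i) hi
      · simp [lineLaw, hi]
      · have : u ≠ 0 := by push_cast at hi; omega
        simp [lineLaw, this]
    · intro h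
      have : u ≠ 0 := by simpa using h 0
      simp [lineLaw, this]
  | succ k ih =>
    constructor
    · rintro (_ | i) hi
      · have h1 := (ih (u + 1)).1 0 (by push_cast at *; omega)
        have h2 := (ih (u - 1)).2 (fun i => by push_cast at *; omega)
        simp only [lineLaw, h1, h2, Nat.choose_zero_right, pow_succ]
        field_simp
        simp
      · have h1 := (ih (u + 1)).1 (i + 1) (by push_cast at *; omega)
        have h2 := (ih (u - 1)).1 i (by push_cast at *; omega)
        simp only [lineLaw, h1, h2, Nat.choose_succ_succ, pow_succ]
        push_cast
        field_simp
        ring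
    · intro h
      have h1 := (ih (u + 1)).2 (fun i hi => h i (by push_cast at *; omega))
      have h2 := (ih (u - 1)).2 (fun i hi => h (i + 1) (by push_cast at *; omega))
      simp [lineLaw, h1, h2]

theorem centralBinom_sq_mul_le (m : ℕ) : m.centralBinom ^ 2 * (2 * m + 1) ≤ 16 ^ m := by
  induction m with
  | zero => simp
  | succ m ih =>
    have h := Nat.succ_mul_centralBinom_succ m
    refine Nat.le_of_mul_le_mul_left ?_ (show 0 < (m + 1) ^ 2 by positivity)
    calc (m + 1) ^ 2 * ((m + 1).centralBinom ^ 2 * (2 * (m + 1) + 1))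
        = ((m + 1) * (m + 1).centralBinom) ^ 2 * (2 * m + 3) := by ring
      _ = (m.centralBinom ^ 2 * (2 * m + 1)) * (4 * ((2 * m + 1) * (2 * m + 3))) := by
        rw [h]; ring
      _ ≤ 16 ^ m * (16 * (m + 1) ^ 2) := Nat.mul_le_mul ih (by nlinarith)
      _ = (m + 1) ^ 2 * 16 ^ (m + 1) := by ring

theorem choose_sq_mul_le (k i : ℕ) : k.choose i ^ 2 * (k + 1) ≤ 4 ^ k := by
  refine (Nat.mul_le_mul_right _ (Nat.pow_le_pow_left (Nat.choose_le_middle i k) 2)).trans ?_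
  obtain ⟨m, rfl | rfl⟩ := Nat.even_or_odd' k
  · have := centralBinom_sq_mul_le m
    rw [Nat.centralBinom] at this
    rwa [Nat.mul_div_cancel_left _ two_pos, pow_mul]
  · have h := centralBinom_sq_mul_le (m + 1)
    have h2 : (m + 1).centralBinom = 2 * (2 * m + 1).choose m := by
      rw [Nat.centralBinom_eq_two_mul_choose, show 2 * (m + 1) = 2 * m + 1 + 1 by ring,
        Nat.choose_succ_succ, Nat.choose_symm_half]
      ring
    rw [h2] at h
    rw [show (2 * m + 1) / 2 = m by omega,
      show 4 ^ (2 * m + 1) = 16 ^ m * 4 by rw [pow_succ, pow_mul]; norm_num]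
    rw [pow_succ 16] at h
    nlinarith [sq_nonneg ((2 * m + 1).choose m)]

theorem lineLaw_sq_le (k : ℕ) (u : ℤ) : lineLaw k u ^ 2 ≤ 1 / (k + 1) := by
  by_cases h : ∃ i : ℕ, u = 2 * i - k
  · obtain ⟨i, hi⟩ := h
    rw [(lineLaw_eq k u).1 i hi, div_pow, div_le_div_iff₀ (by positivity) (by positivity), one_mul,
      ← pow_mul, mul_comm k 2, pow_mul]
    norm_num
    exact_mod_cast choose_sq_mul_le k i
  · rw [(lineLaw_eq k u).2 (by simpa using h), zero_pow two_ne_zero]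
    positivity

/-- Under rotation by `π / 4` planar simple random walk becomes a pair of independent simple random
walks on `ℤ`. -/
theorem nbrAvg_iterate_single (k : ℕ) (y x : ℤ × ℤ) :
    nbrAvg^[k] (Pi.single y 1) x =
      lineLaw k ((x.1 - y.1) + (x.2 - y.2)) * lineLaw k ((x.1 - y.1) - (x.2 - y.2)) := by
  induction k generalizing x with
  | zero =>
    simp only [Function.iterate_zero, id, lineLaw, Pi.single_apply]
    by_cases h : x = y
    · simp [h]
    · have : ¬ ((x.1 - y.1) + (x.2 - y.2) = 0 ∧ (x.1 - y.1) - (x.2 - y.2) = 0) :=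
        fun h' => h (Prod.ext (by omega) (by omega))
      by_cases h1 : (x.1 - y.1) + (x.2 - y.2) = 0
      · simp [h, h1, show ¬ (x.1 - y.1) - (x.2 - y.2) = 0 from fun h2 => this ⟨h1, h2⟩]
      · simp [h, h1]
  | succ k ih =>
    simp only [Function.iterate_succ_apply', nbrAvg, ih, lineLaw, Prod.fst_add, Prod.snd_add]
    generalize hu : x.1 - y.1 + (x.2 - y.2) = u
    generalize hv : x.1 - y.1 - (x.2 - y.2) = v
    rw [show x.1 + 1 - y.1 + (x.2 + 0 - y.2) = u + 1 by omega,
      show x.1 + 1 - y.1 - (x.2 + 0 - y.2) = v + 1 by omega,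
      show x.1 + -1 - y.1 + (x.2 + 0 - y.2) = u - 1 by omega,
      show x.1 + -1 - y.1 - (x.2 + 0 - y.2) = v - 1 by omega,
      show x.1 + 0 - y.1 + (x.2 + 1 - y.2) = u + 1 by omega,
      show x.1 + 0 - y.1 - (x.2 + 1 - y.2) = v - 1 by omega,
      show x.1 + 0 - y.1 + (x.2 + -1 - y.2) = u - 1 by omega,
      show x.1 + 0 - y.1 - (x.2 + -1 - y.2) = v + 1 by omega]
    ring

theorem nbrAvg_iterate_single_le (k : ℕ) (y x : ℤ × ℤ) :
    nbrAvg^[k] (Pi.single y 1) x ≤ 1 / (k + 1) := by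
  rw [nbrAvg_iterate_single]
  nlinarith [lineLaw_sq_le k ((x.1 - y.1) + (x.2 - y.2)),
    lineLaw_sq_le k ((x.1 - y.1) - (x.2 - y.2)),
    two_mul_le_add_sq (lineLaw k ((x.1 - y.1) + (x.2 - y.2)))
      (lineLaw k ((x.1 - y.1) - (x.2 - y.2)))]

/-! ### Escape from a pair of points -/

theorem nbrAvg_iterate_pair_le (d : ℤ × ℤ) (k m : ℕ) :
    nbrAvg^[k] (({0, d} : Set (ℤ × ℤ)).indicator (escape {0, d} m)) 0 ≤
      2 * escape {0, d} m 0 / (k + 1) := by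
  have hd : escape {0, d} m d = escape {0, d} m 0 := by
    simpa using escape_pair_reflect d m 0
  have h0 := escape_nonneg {0, d} m 0
  have hle : ({0, d} : Set (ℤ × ℤ)).indicator (escape {0, d} m) ≤ fun y =>
      escape {0, d} m 0 * ((Pi.single 0 1 : ℤ × ℤ → ℝ) y + (Pi.single d 1 : ℤ × ℤ → ℝ) y) := by
    intro y
    classical
    simp only [Set.indicator_apply, Set.mem_insert_iff, Set.mem_singleton_iff, Pi.single_apply]
    simp only [Pi.zero_apply] at h0
    by_cases h1 : y = 0
    · subst h1
      simp only [true_or, if_true]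
      split_ifs <;> linarith
    · by_cases h2 : y = d
      · subst h2
        simp [h1, hd]
      · simp [h1, h2]
  refine (nbrAvg_iterate_mono hle k 0).trans ?_
  rw [nbrAvg_iterate_comb]
  have h1 := nbrAvg_iterate_single_le k 0 0
  have h2 := nbrAvg_iterate_single_le k d 0
  calc _ ≤ escape {0, d} m 0 * (1 / (k + 1) + 1 / (k + 1)) :=
        mul_le_mul_of_nonneg_left (add_le_add h1 h2) h0
    _ = _ := by ring

/-- The walk avoids its starting point and one further point for `N` steps with probability at
least of order `1 / log N`. -/
theorem le_escape_pair (d : ℤ × ℤ) (N : ℕ) :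
    1 / (4 * (1 + Real.log (4 * N + 1))) ≤ escape {0, d} N 0 := by
  set ρ := escape {0, d} N 0 with hρ
  have hlog : 0 ≤ Real.log (4 * N + 1) := Real.log_nonneg (by linarith [Nat.cast_nonneg (α := ℝ) N])
  rcases Nat.eq_zero_or_pos N with rfl | hN
  · simp only [hρ, escape]
    rw [div_le_one (by linarith)]
    linarith
  have hN' : (0 : ℝ) < N := by exact_mod_cast hN
  -- The last visit to the pair up to time `5 N` falls after time `4 N` with probability at most
  -- `N * (2 / (4 * N))`, that is `1 / 2`.
  have h := last_exit {0, d} (5 * N) 0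
  rw [Set.indicator_of_notMem (by simp), sub_zero,
    show 5 * N + 1 = (4 * N + 1) + N by ring, Finset.sum_range_add] at h
  have hfirst : ∑ k ∈ Finset.range (4 * N + 1),
      nbrAvg^[k] (({0, d} : Set (ℤ × ℤ)).indicator (escape {0, d} (5 * N - k))) 0 ≤
      2 * ρ * (1 + Real.log (4 * N + 1)) := by
    have hH := harmonic_le_one_add_log (4 * N + 1)
    have hcast : ((harmonic (4 * N + 1) : ℚ) : ℝ) =
        ∑ k ∈ Finset.range (4 * N + 1), 1 / ((k : ℝ) + 1) := by
      simp [harmonic]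
    rw [hcast] at hH
    push_cast at hH
    have hρ0 : 0 ≤ ρ := escape_nonneg _ N 0
    refine le_trans ?_ (mul_le_mul_of_nonneg_left hH (by positivity))
    rw [Finset.mul_sum]
    refine Finset.sum_le_sum fun k hk => (nbrAvg_iterate_pair_le d k _).trans ?_
    rw [← mul_div_assoc, mul_one]
    have : escape {0, d} (5 * N - k) 0 ≤ ρ :=
      escape_antitone _ (by have := Finset.mem_range.1 hk; omega) 0
    gcongr
  have hlast : ∑ k ∈ Finset.range N,
      nbrAvg^[4 * N + 1 + k] (({0, d} : Set (ℤ × ℤ)).indicator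
        (escape {0, d} (5 * N - (4 * N + 1 + k)))) 0 ≤ 1 / 2 := by
    have : ∀ k ∈ Finset.range N, nbrAvg^[4 * N + 1 + k] (({0, d} : Set (ℤ × ℤ)).indicator
        (escape {0, d} (5 * N - (4 * N + 1 + k)))) 0 ≤ 1 / (2 * N) := by
      intro k _
      refine (nbrAvg_iterate_pair_le d _ _).trans ?_
      have h1 := escape_le_one {0, d} (5 * N - (4 * N + 1 + k)) 0
      rw [div_le_div_iff₀ (by positivity) (by positivity)]
      push_cast
      nlinarith
    refine (Finset.sum_le_sum this).trans (le_of_eq ?_)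
    rw [Finset.sum_const, Finset.card_range, nsmul_eq_mul]
    field_simp
  rw [div_le_iff₀ (by positivity)]
  linarith

/-! ### Independence of past, present and future -/

/-- The four unit steps. -/
def unitSteps : Finset (ℤ × ℤ) := {(1, 0), (-1, 0), (0, 1), (0, -1)}

theorem nbrAvg_eq_sum (f : ℤ × ℤ → ℝ) (x : ℤ × ℤ) :
    nbrAvg f x = ∑ e ∈ unitSteps, 1 / 4 * f (x + e) := by
  simp only [nbrAvg, unitSteps]
  rw [Finset.sum_insert (by decide), Finset.sum_insert (by decide), Finset.sum_insert (by decide),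
    Finset.sum_singleton]
  ring

/-- The partial sums `ξ 0 + … + ξ (i - 1)`, `1 ≤ i ≤ m`, translated by `x`, stay outside `A`. -/
def Avoids (A : Set (ℤ × ℤ)) (m : ℕ) (x : ℤ × ℤ) (ξ : ℕ → ℤ × ℤ) : Prop :=
  ∀ i, 1 ≤ i → i ≤ m → x + ∑ l ∈ Finset.range i, ξ l ∉ A

/-- The steps of a loop of length `8` around the point that lies diagonally below and to the left
of its start: left, down, right, up, twice each. -/
def ringStep (l : ℕ) : ℤ × ℤ :=
  if l < 2 then (-1, 0) else if l < 4 then (0, -1) else if l < 6 then (1, 0) else (0, 1)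

theorem ringStep_mem (l : ℕ) : ringStep l ∈ unitSteps := by
  unfold ringStep
  split_ifs <;> decide

section Probability

variable {Ω : Type*} [MeasurableSpace Ω] {P : Measure Ω} {X : ℕ → Ω → ℤ × ℤ}

theorem IsSimpleRandomSteps.comp (hX : IsSimpleRandomSteps P X) {σ : ℕ → ℕ}
    (hσ : Function.Injective σ) : IsSimpleRandomSteps P fun j => X (σ j) :=
  ⟨fun _ => hX.measurable _, hX.indep.precomp hσ, fun _ => hX.law _⟩

theorem IsSimpleRandomSteps.measure_eq (hX : IsSimpleRandomSteps P X) (j : ℕ) {e : ℤ × ℤ}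
    (he : e ∈ unitSteps) : P {ω | X j ω = e} = 1 / 4 :=
  hX.law j e (by simpa [unitSteps] using he)

theorem IsSimpleRandomSteps.measurableSet (hX : IsSimpleRandomSteps P X) {S : Finset ℕ}
    {E : (ℕ → ℤ × ℤ) → Prop} (hE : DependsOn E (S : Set ℕ)) :
    MeasurableSet {ω | E fun j => X j ω} := by
  have h1 : Measurable fun ω => fun i : S => X i ω :=
    measurable_pi_lambda _ fun i => hX.measurable i
  have h2 : MeasurableSet {v : S → ℤ × ℤ | E fun j => if h : j ∈ S then v ⟨j, h⟩ else 0} :=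
    (Set.to_countable _).measurableSet
  convert h1 h2 using 1
  ext ω
  exact iff_of_eq (hE fun i hi => by simp [Finset.mem_coe.1 hi])

/-- Events that depend on disjoint finite sets of steps are independent. -/
theorem IsSimpleRandomSteps.measure_and (hX : IsSimpleRandomSteps P X) {S T : Finset ℕ}
    (hST : Disjoint S T) {E F : (ℕ → ℤ × ℤ) → Prop} (hE : DependsOn E (S : Set ℕ))
    (hF : DependsOn F (T : Set ℕ)) :
    P {ω | E (fun j => X j ω) ∧ F (fun j => X j ω)} =
      P {ω | E fun j => X j ω} * P {ω | F fun j => X j ω} := by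
  have hind := hX.indep.indepFun_finset S T hST hX.measurable
  have key : ∀ (S : Finset ℕ) (E : (ℕ → ℤ × ℤ) → Prop), DependsOn E (S : Set ℕ) →
      {ω | E fun j => X j ω} = (fun ω => fun i : S => X i ω) ⁻¹'
        {v : S → ℤ × ℤ | E fun j => if h : j ∈ S then v ⟨j, h⟩ else 0} := by
    intro S E hE
    ext ω
    exact iff_of_eq (hE fun i hi => by simp [Finset.mem_coe.1 hi])
  have := hind.measure_inter_preimage_eq_mul
    {v : S → ℤ × ℤ | E fun j => if h : j ∈ S then v ⟨j, h⟩ else 0}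
    {v : T → ℤ × ℤ | F fun j => if h : j ∈ T then v ⟨j, h⟩ else 0}
    (Set.to_countable _).measurableSet (Set.to_countable _).measurableSet
  rw [← key S E hE, ← key T F hF] at this
  exact this

theorem IsSimpleRandomSteps.ae_mem [IsProbabilityMeasure P] (hX : IsSimpleRandomSteps P X) :
    ∀ᵐ ω ∂P, ∀ j, X j ω ∈ unitSteps := by
  rw [ae_all_iff]
  intro j
  have hm : ∀ e, MeasurableSet {ω | X j ω = e} := fun e =>
    hX.measurable j (measurableSet_singleton e)
  have : P {ω | X j ω ∈ unitSteps} = 1 := by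
    have hU : {ω | X j ω ∈ unitSteps} = ⋃ e ∈ unitSteps, {ω | X j ω = e} := by
      ext ω; simp
    rw [hU, measure_biUnion_finset (fun a _ b _ hab => Set.disjoint_left.2 fun ω h1 h2 =>
      hab (h1.symm.trans h2)) fun e _ => hm e, Finset.sum_congr rfl fun e he => hX.measure_eq j he,
      Finset.sum_const, show unitSteps.card = 4 from rfl]
    simp [ENNReal.mul_inv_cancel]
  have hms : MeasurableSet {ω | X j ω ∈ unitSteps} :=
    hX.measurable j (Set.to_countable (unitSteps : Set (ℤ × ℤ))).measurableSet
  exact (prob_compl_eq_zero_iff hms).2 this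

theorem dependsOn_avoids (A : Set (ℤ × ℤ)) (m : ℕ) (x : ℤ × ℤ) (σ : ℕ → ℕ) (T : Set ℕ)
    (hT : ∀ l < m, σ l ∈ T) : DependsOn (fun ξ : ℕ → ℤ × ℤ => Avoids A m x fun l => ξ (σ l)) T := by
  intro ξ η h
  refine propext (forall_congr' fun i => imp_congr_right fun _ => imp_congr_right fun hi => ?_)
  rw [Finset.sum_congr rfl fun l hl => h (σ l) (hT l ((Finset.mem_range.1 hl).trans_le hi))]

theorem IsSimpleRandomSteps.escape_le (hX : IsSimpleRandomSteps P X) [IsProbabilityMeasure P]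
    (A : Set (ℤ × ℤ)) (m : ℕ) (x : ℤ × ℤ) :
    ENNReal.ofReal (escape A m x) ≤ P {ω | Avoids A m x fun j => X j ω} := by
  induction m generalizing x X with
  | zero =>
    have : {ω | Avoids A 0 x fun j => X j ω} = Set.univ :=
      Set.eq_univ_of_forall fun ω i h1 h2 => by omega
    simp [this, escape]
  | succ m ih =>
    -- Decomposition according to the first step `e`.
    have hstep : ∀ e ∈ unitSteps, ENNReal.ofReal (1 / 4 * Aᶜ.indicator (escape A m) (x + e)) ≤
        P {ω | X 0 ω = e ∧ (x + e ∉ A ∧ Avoids A m (x + e) fun j => X (j + 1) ω)} := by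
      intro e he
      by_cases hA : x + e ∈ A
      · simp [hA]
      · have hd1 : DependsOn (fun ξ : ℕ → ℤ × ℤ => ξ 0 = e) (({0} : Finset ℕ) : Set ℕ) :=
          fun ξ η h => congrArg (· = e) (h 0 (by simp))
        have hd2 : DependsOn (fun ξ : ℕ → ℤ × ℤ => Avoids A m (x + e) fun j => ξ (j + 1))
            ((Finset.Icc 1 m : Finset ℕ) : Set ℕ) :=
          dependsOn_avoids A m (x + e) (· + 1) _ fun l hl => by
            simp only [Finset.coe_Icc, Set.mem_Icc]; omega
        have hmul := hX.measure_and (by simp) hd1 hd2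
        simp only [hA, not_false_eq_true, true_and]
        rw [hmul, hX.measure_eq 0 he, Set.indicator_of_mem (by simpa using hA),
          ENNReal.ofReal_mul (by norm_num)]
        refine mul_le_mul' (le_of_eq ?_) (ih (hX.comp (add_left_injective 1)) (x + e))
        rw [ENNReal.ofReal_div_of_pos (by norm_num)]
        simp
    have hmeas : ∀ e ∈ unitSteps, MeasurableSet
        {ω | X 0 ω = e ∧ (x + e ∉ A ∧ Avoids A m (x + e) fun j => X (j + 1) ω)} := by
      intro e _
      refine hX.measurableSet (S := Finset.range (m + 1)) (E := fun ξ => ξ 0 = e ∧ (x + e ∉ A ∧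
        Avoids A m (x + e) fun j => ξ (j + 1))) fun ξ η h => ?_
      have h2 := dependsOn_avoids A m (x + e) (· + 1) (Finset.range (m + 1) : Set ℕ)
        (fun l hl => by simpa using hl) h
      simp only at h2
      simp only [h2]
      rw [h 0 (by simp)]
    calc ENNReal.ofReal (escape A (m + 1) x)
        = ∑ e ∈ unitSteps, ENNReal.ofReal (1 / 4 * Aᶜ.indicator (escape A m) (x + e)) := by
          rw [escape, nbrAvg_eq_sum, ENNReal.ofReal_sum_of_nonneg]
          exact fun e _ => mul_nonneg (by norm_num)
            (Set.indicator_nonneg (fun z _ => escape_nonneg A m z) _)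
      _ ≤ ∑ e ∈ unitSteps,
          P {ω | X 0 ω = e ∧ (x + e ∉ A ∧ Avoids A m (x + e) fun j => X (j + 1) ω)} :=
          Finset.sum_le_sum hstep
      _ = P (⋃ e ∈ unitSteps,
          {ω | X 0 ω = e ∧ (x + e ∉ A ∧ Avoids A m (x + e) fun j => X (j + 1) ω)}) :=
          (measure_biUnion_finset (fun a _ b _ hab => Set.disjoint_left.2 fun ω h1 h2 =>
            hab (h1.1.symm.trans h2.1)) hmeas).symm
      _ ≤ _ := by
          refine measure_mono (Set.iUnion₂_subset fun e _ ω hω => ?_)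
          obtain ⟨h0, hxe, hav⟩ := hω
          rintro (_ | _ | i) h1 h2
          · omega
          · simpa [h0] using hxe
          · rw [Finset.sum_range_succ', h0, add_comm (Finset.sum _ _), ← add_assoc]
            exact hav (i + 1) (by omega) (by omega)

/-- The walk with steps `ξ`, seen from its position at time `j` and run backwards to time `0`, does
not visit `0` or `d`; the eight steps after time `j` form a ring; and the walk seen from its
position at time `j + 8` does not visit `0` or `-d` during `N` further steps. For `d = (1, 1)`, the
displacement from the centre of the ring to its start, the centre stays unvisited. Beyond `j` the
reversed sequence is continued by the identity, so that the rearrangement of the steps is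
injective. -/
def IsRing (d : ℤ × ℤ) (N j : ℕ) (ξ : ℕ → ℤ × ℤ) : Prop :=
  Avoids {0, d} j 0 (fun l => ξ (if l < j then j - 1 - l else l)) ∧
    (∀ l < 8, ξ (j + l) = ringStep l) ∧ Avoids {0, -d} N 0 (fun l => ξ (j + 8 + l))

theorem dependsOn_isRing (d : ℤ × ℤ) (N j : ℕ) :
    DependsOn (IsRing d N j) (Finset.range (j + 8 + N) : Set ℕ) := by
  intro ξ η h
  have h1 := dependsOn_avoids {0, d} j 0 (fun l => if l < j then j - 1 - l else l)
    (Finset.range (j + 8 + N) : Set ℕ) (fun l hl => by simp [hl]; omega) h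
  have h3 := dependsOn_avoids {0, -d} N 0 (fun l => j + 8 + l)
    (Finset.range (j + 8 + N) : Set ℕ) (fun l hl => by simp; omega) h
  simp only at h1 h3
  simp only [IsRing, h1, h3]
  congr 2
  exact propext (forall₂_congr fun l hl => by rw [h (j + l) (by simp; omega)])

/-- A ring is made at a given time with probability at least of order `(1 / log N) ^ 2`: past,
present and future are independent. -/
theorem IsSimpleRandomSteps.le_measure_isRing (hX : IsSimpleRandomSteps P X)
    [IsProbabilityMeasure P] (d : ℤ × ℤ) {N j : ℕ} (hj : j ≤ N) :
    ENNReal.ofReal ((1 / 4) ^ 8 * (1 / (4 * (1 + Real.log (4 * N + 1)))) ^ 2) ≤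
      P {ω | IsRing d N j fun i => X i ω} := by
  set c := 1 / (4 * (1 + Real.log (4 * N + 1))) with hc
  have hc0 : 0 ≤ c := by
    have : 0 ≤ Real.log (4 * N + 1) := Real.log_nonneg (by linarith [Nat.cast_nonneg (α := ℝ) N])
    positivity
  set σ : ℕ → ℕ := fun l => if l < j then j - 1 - l else l with hσ
  have hσi : Function.Injective σ := by
    intro a b hab
    simp only [hσ] at hab
    split_ifs at hab <;> omega
  have hd1 : DependsOn (fun ξ : ℕ → ℤ × ℤ => Avoids {0, d} j 0 fun l => ξ (σ l))
      (Finset.range j : Set ℕ) :=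
    dependsOn_avoids _ _ _ _ _ fun l hl => by simp [hσ, hl]; omega
  have hd2 : DependsOn (fun ξ : ℕ → ℤ × ℤ => ∀ l < 8, ξ (j + l) = ringStep l)
      (Finset.Ico j (j + 8) : Set ℕ) :=
    fun ξ η h => propext (forall₂_congr fun l hl => by rw [h (j + l) (by simp; omega)])
  have hd3 : DependsOn (fun ξ : ℕ → ℤ × ℤ => Avoids {0, -d} N 0 fun l => ξ (j + 8 + l))
      (Finset.Ico (j + 8) (j + 8 + N) : Set ℕ) :=
    dependsOn_avoids _ _ _ _ _ fun l hl => by simp; omega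
  have hd23 : DependsOn (fun ξ : ℕ → ℤ × ℤ => (∀ l < 8, ξ (j + l) = ringStep l) ∧
      Avoids {0, -d} N 0 fun l => ξ (j + 8 + l)) (Finset.Ico j (j + 8 + N) : Set ℕ) := by
    intro ξ η h
    have h2 := hd2 (x := ξ) (y := η) fun i hi => h i (by simp at hi ⊢; omega)
    have h3 := hd3 (x := ξ) (y := η) fun i hi => h i (by simp at hi ⊢; omega)
    simp only at h2 h3
    simp only [h2, h3]
  have e1 : ENNReal.ofReal c ≤ P {ω | Avoids {0, d} j 0 fun l => X (σ l) ω} :=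
    le_trans (ENNReal.ofReal_le_ofReal ((le_escape_pair d N).trans (escape_antitone _ hj 0)))
      ((hX.comp hσi).escape_le {0, d} j 0)
  have e3 : ENNReal.ofReal c ≤ P {ω | Avoids {0, -d} N 0 fun l => X (j + 8 + l) ω} :=
    le_trans (ENNReal.ofReal_le_ofReal (le_escape_pair (-d) N))
      ((hX.comp (add_right_injective (j + 8))).escape_le {0, -d} N 0)
  have e2 : P {ω | ∀ l < 8, X (j + l) ω = ringStep l} = ENNReal.ofReal ((1 / 4) ^ 8) := by
    have hX' := hX.comp (add_right_injective j)
    have := hX'.indep.measure_inter_preimage_eq_mul (Finset.range 8)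
      (sets := fun l => {ringStep l}) fun l _ => measurableSet_singleton _
    have hset : {ω | ∀ l < 8, X (j + l) ω = ringStep l} =
        ⋂ l ∈ Finset.range 8, (fun ω => X (j + l) ω) ⁻¹' {ringStep l} := by
      ext ω; simp
    rw [hset, this, Finset.prod_congr rfl fun l _ =>
      show P (X (j + l) ⁻¹' {ringStep l}) = 1 / 4 from hX'.measure_eq l (ringStep_mem l),
      Finset.prod_const, Finset.card_range, ENNReal.ofReal_pow (by norm_num),
      ENNReal.ofReal_div_of_pos (by norm_num)]
    simp
  have hm1 := hX.measure_and (Finset.disjoint_left.2 fun i h1 h2 => by simp at h1 h2; omega)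
    hd1 hd23
  have hm2 := hX.measure_and (Finset.disjoint_left.2 fun i h1 h2 => by simp at h1 h2; omega)
    hd2 hd3
  have : P {ω | IsRing d N j fun i => X i ω} = _ := hm1
  rw [this, hm2, e2, ENNReal.ofReal_mul (by norm_num), pow_two c, ENNReal.ofReal_mul hc0,
    mul_left_comm (P _)]
  exact mul_le_mul' le_rfl (mul_le_mul' e1 e3)

end Probability

/-! ### Rings and their centres -/

/-- The position after `l` steps of the ring, relative to its centre. -/
def ringPos (l : ℕ) : ℤ × ℤ := (1, 1) + ∑ i ∈ Finset.range l, ringStep i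

/-- The point `z` is unvisited up to time `2n`, and the path runs through the eight edges around
it. -/
def IsRingCentre (s : ℕ → ℤ × ℤ) (n : ℕ) (z : ℤ × ℤ) : Prop :=
  z ∈ unvisited s n ∧ ∃ j, j + 8 ≤ 2 * n ∧ ∀ l ≤ 8, s (j + l) = z + ringPos l

theorem ringPos_succ (l : ℕ) : ringPos (l + 1) = ringPos l + ringStep l := by
  rw [ringPos, Finset.sum_range_succ, ← add_assoc, ringPos]

theorem ringPos_ne_zero : ∀ l ≤ 8, ringPos l ≠ 0 := by
  decide

theorem ringPos_ne_start : ∀ l, 1 ≤ l → l < 8 → ringPos l ≠ (1, 1) := by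
  intro l h1 h2
  interval_cases l <;> decide

section Rings

variable {Ω : Type*} {X : ℕ → Ω → ℤ × ℤ} {ω : Ω} {N j : ℕ}

theorem walk_add (X : ℕ → Ω → ℤ × ℤ) (ω : Ω) (a b : ℕ) :
    walk X ω (a + b) = walk X ω a + ∑ l ∈ Finset.range b, X (a + l) ω :=
  Finset.sum_range_add _ a b

theorem IsRing.walk_eq (h : IsRing (1, 1) N j fun i => X i ω) :
    ∀ l ≤ 8, walk X ω (j + l) = walk X ω j - (1, 1) + ringPos l := by
  intro l hl
  rw [walk_add, Finset.sum_congr rfl fun i hi =>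
    h.2.1 i ((Finset.mem_range.1 hi).trans_le hl), ringPos, ← add_assoc, sub_add_cancel]

theorem IsRing.walk_return (h : IsRing (1, 1) N j fun i => X i ω) :
    walk X ω (j + 8) = walk X ω j := by
  rw [h.walk_eq 8 le_rfl, show ringPos 8 = (1, 1) by decide, sub_add_cancel]

theorem IsRing.walk_future (h : IsRing (1, 1) N j fun i => X i ω) {i : ℕ} (h1 : 1 ≤ i)
    (hi : i ≤ N) : walk X ω (j + 8 + i) ≠ walk X ω j ∧
      walk X ω (j + 8 + i) ≠ walk X ω j - (1, 1) := by
  have := h.2.2 i h1 hi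
  rw [walk_add X ω (j + 8) i, h.walk_return]
  simp only [zero_add, Set.mem_insert_iff, Set.mem_singleton_iff, not_or] at this
  refine ⟨fun he => this.1 (by simpa using he), fun he => this.2 ?_⟩
  rw [sub_eq_add_neg] at he
  exact add_left_cancel he

theorem IsRing.walk_past (h : IsRing (1, 1) N j fun i => X i ω) {i : ℕ} (hi : i < j) :
    walk X ω i ≠ walk X ω j - (1, 1) := by
  have h1 := h.1 (j - i) (by omega) (by omega)
  have hsum : ∑ l ∈ Finset.range (j - i), X (if l < j then j - 1 - l else l) ω =
      ∑ l ∈ Finset.range (j - i), X (i + l) ω := by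
    rw [← Finset.sum_range_reflect]
    refine Finset.sum_congr rfl fun l hl => ?_
    have := Finset.mem_range.1 hl
    rw [if_pos (by omega), show j - 1 - (j - i - 1 - l) = i + l by omega]
  have h2 := walk_add X ω i (j - i)
  rw [show i + (j - i) = j by omega] at h2
  intro he
  apply h1
  rw [hsum, zero_add, ← sub_eq_iff_eq_add'.2 h2, he, sub_sub_cancel]
  simp

theorem IsRing.isRingCentre {n : ℕ} (h : IsRing (1, 1) (2 * n) j fun i => X i ω)
    (hj : j + 8 ≤ 2 * n) : IsRingCentre (walk X ω) n (walk X ω j - (1, 1)) := by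
  refine ⟨fun i hi => ?_, j, hj, h.walk_eq⟩
  rcases lt_or_ge i j with h1 | h1
  · exact h.walk_past h1
  rcases le_or_gt i (j + 8) with h2 | h2
  · obtain ⟨l, rfl⟩ := Nat.exists_eq_add_of_le h1
    rw [h.walk_eq l (by omega)]
    simpa using ringPos_ne_zero l (by omega)
  · obtain ⟨l, rfl⟩ := Nat.exists_eq_add_of_lt h2
    exact (h.walk_future (i := l + 1) (by omega) (by omega)).2

/-- Two rings that are followed by an escape do not start at the same point, since the earlier one
would be followed by a return. -/
theorem IsRing.walk_ne {j' : ℕ} (hN : 8 ≤ N) (h : IsRing (1, 1) N j fun i => X i ω)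
    (h' : IsRing (1, 1) N j' fun i => X i ω) (hlt : j < j') (hj' : j' ≤ N) :
    walk X ω j ≠ walk X ω j' := by
  intro he
  rcases lt_trichotomy j' (j + 8) with h1 | rfl | h1
  · obtain ⟨l, rfl⟩ := Nat.exists_eq_add_of_lt hlt
    have := h.walk_eq (l + 1) (by omega)
    rw [← add_assoc, ← he] at this
    refine ringPos_ne_start (l + 1) (by omega) (by omega) ?_
    rw [sub_add_eq_add_sub, eq_sub_iff_add_eq] at this
    exact (add_left_cancel this).symm
  · exact (h.walk_future (i := 8) (by omega) hN).1 (h'.walk_return.trans he.symm)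
  · obtain ⟨l, rfl⟩ := Nat.exists_eq_add_of_lt h1
    exact (h.walk_future (i := l + 1) (by omega) (by omega)).1 he.symm

open Classical in
/-- Different rings have different centres. -/
theorem card_isRing_le (X : ℕ → Ω → ℤ × ℤ) (ω : Ω) (n : ℕ) :
    (((Finset.range (2 * n - 7)).filter fun j => IsRing (1, 1) (2 * n) j fun i => X i ω).card :
      ℕ∞) ≤ {z | IsRingCentre (walk X ω) n z}.encard := by
  rw [← Set.encard_coe_eq_coe_finsetCard]
  refine Set.encard_le_encard_of_injOn (f := fun j => walk X ω j - (1, 1)) ?_ ?_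
  · intro j hj
    simp only [Finset.coe_filter, Finset.mem_range, Set.mem_ofPred_eq] at hj
    exact hj.2.isRingCentre (by omega)
  · intro j hj j' hj' he
    simp only [Finset.coe_filter, Finset.mem_range, Set.mem_ofPred_eq] at hj hj'
    have he' := sub_left_injective he
    by_contra hne
    rcases lt_or_gt_of_ne hne with hlt | hlt
    · exact hj.2.walk_ne (by omega) hj'.2 hlt (by omega) he'
    · exact hj'.2.walk_ne (by omega) hj.2 hlt (by omega) he'.symm

end Rings

/-! ### Lattice holes -/

theorem latticeGraph_adj_iff {z w : ℤ × ℤ} : latticeGraph.Adj z w ↔ w - z ∈ unitSteps := by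
  simp only [latticeGraph, unitSteps, Finset.mem_insert, Finset.mem_singleton, Prod.ext_iff,
    Prod.fst_sub, Prod.snd_sub]
  constructor
  · intro h
    rcases abs_cases (z.1 - w.1) with ⟨h1, _⟩ | ⟨h1, _⟩ <;>
      rcases abs_cases (z.2 - w.2) with ⟨h2, _⟩ | ⟨h2, _⟩ <;> rw [h1, h2] at h <;> omega
  · rintro (⟨h1, h2⟩ | ⟨h1, h2⟩ | ⟨h1, h2⟩ | ⟨h1, h2⟩)
    · rw [show z.1 - w.1 = -1 by omega, show z.2 - w.2 = 0 by omega]; rfl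
    · rw [show z.1 - w.1 = 1 by omega, show z.2 - w.2 = 0 by omega]; rfl
    · rw [show z.1 - w.1 = 0 by omega, show z.2 - w.2 = -1 by omega]; rfl
    · rw [show z.1 - w.1 = 0 by omega, show z.2 - w.2 = 1 by omega]; rfl

/-- All neighbours of the centre of a ring are visited. -/
theorem IsRingCentre.add_notMem {s : ℕ → ℤ × ℤ} {n : ℕ} {z e : ℤ × ℤ} (h : IsRingCentre s n z)
    (he : e ∈ unitSteps) : z + e ∉ unvisited s n := by
  obtain ⟨-, j, hj, hl⟩ := h
  have : ∃ l ≤ 8, ringPos l = e := by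
    revert e
    decide
  obtain ⟨l, hl8, rfl⟩ := this
  exact fun hz => hz (j + l) (by omega) (hl l hl8)

/-- The centre of a ring forms a lattice hole. -/
theorem encard_isRingCentre_le_latticeHoleCount (s : ℕ → ℤ × ℤ) (n : ℕ) :
    {z | IsRingCentre s n z}.encard ≤ latticeHoleCount s n 1 := by
  have hsupp : ∀ C : LatticeHole s n, ((1 : ℝ≥0) : ℝ≥0∞) ≤ (C.supp.encard : ℝ≥0∞) := by
    intro C
    have : (1 : ℕ∞) ≤ C.supp.encard := Set.one_le_encard_iff_nonempty.2 C.nonempty_supp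
    rwa [ENNReal.coe_one, ← ENat.toENNReal_one, ENat.toENNReal_le]
  have hwalk : ∀ {a b : unvisited s n}, (latticeGraph.induce (unvisited s n)).Walk a b →
      IsRingCentre s n a.1 → a = b := by
    intro a b p ha
    cases p with
    | nil => rfl
    | @cons _ v _ hadj _ =>
      have hadj' : latticeGraph.Adj a.1 v.1 := hadj
      rw [latticeGraph_adj_iff] at hadj'
      exact absurd v.2 (by simpa using ha.add_notMem hadj')
  let f : {z | IsRingCentre s n z} → {C : LatticeHole s n |
      ((1 : ℝ≥0) : ℝ≥0∞) ≤ (C.supp.encard : ℝ≥0∞)} := fun z =>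
    ⟨(latticeGraph.induce (unvisited s n)).connectedComponentMk ⟨z.1, z.2.1⟩, hsupp _⟩
  refine ENat.card_le_card_of_injective (f := f) fun z w hzw => ?_
  have hr : (latticeGraph.induce (unvisited s n)).Reachable ⟨z.1, z.2.1⟩ ⟨w.1, w.2.1⟩ :=
    SimpleGraph.ConnectedComponent.exact (congrArg Subtype.val hzw)
  obtain ⟨p⟩ := hr
  exact Subtype.ext (congrArg (fun v : unvisited s n => v.1) (hwalk p z.2))

theorem eq_univ_of_add_mem {S : Set (ℤ × ℤ)} (hne : S.Nonempty)
    (h : ∀ z ∈ S, ∀ e ∈ unitSteps, z + e ∈ S) : S = Set.univ := by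
  obtain ⟨z, hz⟩ := hne
  have h1 : ∀ a : ℤ, z + (a, 0) ∈ S := by
    intro a
    induction a using Int.induction_on with
    | zero => rwa [show z + ((0 : ℤ), (0 : ℤ)) = z from add_zero z]
    | succ i ih => simpa [add_assoc] using h _ ih (1, 0) (by decide)
    | pred i ih => simpa [add_assoc, sub_eq_add_neg] using h _ ih (-1, 0) (by decide)
  have h2 : ∀ a b : ℤ, z + (a, b) ∈ S := by
    intro a b
    induction b using Int.induction_on with
    | zero => exact h1 a
    | succ i ih => simpa [add_assoc] using h _ ih (0, 1) (by decide)
    | pred i ih => simpa [add_assoc, sub_eq_add_neg] using h _ ih (0, -1) (by decide)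
  refine Set.eq_univ_of_forall fun w => ?_
  have := h2 (w - z).1 (w - z).2
  rwa [Prod.mk.eta, add_sub_cancel] at this

/-- Each lattice hole contains a neighbour of a visited point. -/
theorem LatticeHole.exists_near {s : ℕ → ℤ × ℤ} {n : ℕ} (C : LatticeHole s n) :
    ∃ z : unvisited s n, (latticeGraph.induce (unvisited s n)).connectedComponentMk z = C ∧
      ∃ k ≤ 2 * n, ∃ e ∈ unitSteps, z.1 = s k + e := by
  by_contra! hcon
  have huniv : {z | ∃ hz : z ∈ unvisited s n,
      (latticeGraph.induce (unvisited s n)).connectedComponentMk ⟨z, hz⟩ = C} = Set.univ := by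
    refine eq_univ_of_add_mem ?_ ?_
    · obtain ⟨v, hv⟩ := C.nonempty_supp
      exact ⟨v.1, v.2, hv⟩
    · rintro z ⟨hz, hC⟩ e he
      have hne : -e ∈ unitSteps := by revert e; decide
      have hze : z + e ∈ unvisited s n := fun k hk hsk =>
        hcon ⟨z, hz⟩ hC k hk (-e) hne (by rw [hsk, add_neg_cancel_right])
      refine ⟨hze, hC ▸ SimpleGraph.ConnectedComponent.sound (SimpleGraph.Adj.reachable ?_)⟩
      show latticeGraph.Adj (z + e) z
      rw [latticeGraph_adj_iff]
      simpa using hne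
  obtain ⟨h0, -⟩ : s 0 ∈ {z | ∃ hz : z ∈ unvisited s n,
      (latticeGraph.induce (unvisited s n)).connectedComponentMk ⟨z, hz⟩ = C} :=
    huniv ▸ Set.mem_univ _
  exact h0 0 (Nat.zero_le _) rfl

theorem latticeHoleCount_le (s : ℕ → ℤ × ℤ) (n : ℕ) (r : ℝ≥0) :
    latticeHoleCount s n r ≤ ((4 * (2 * n + 1) : ℕ) : ℕ∞) := by
  choose g hg hnear using fun C : LatticeHole s n => C.exists_near
  set F : Finset (ℤ × ℤ) :=
    (Finset.range (2 * n + 1) ×ˢ unitSteps).image fun p => s p.1 + p.2 with hF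
  have hcard : F.card ≤ 4 * (2 * n + 1) := by
    refine Finset.card_image_le.trans ?_
    rw [Finset.card_product, Finset.card_range, show unitSteps.card = 4 from rfl, mul_comm]
  calc latticeHoleCount s n r ≤ (F : Set (ℤ × ℤ)).encard := by
        refine Set.encard_le_encard_of_injOn (f := fun C => (g C).1) ?_ ?_
        · intro C _
          obtain ⟨k, hk, e, he, hz⟩ := hnear C
          simp only [hF, Finset.coe_image, Set.mem_image, Finset.mem_coe, Finset.mem_product,
            Finset.mem_range]
          exact ⟨(k, e), ⟨by omega, he⟩, hz.symm⟩
        · intro C _ C' _ h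
          rw [← hg C, ← hg C', Subtype.ext h]
    _ = F.card := Set.encard_coe_eq_coe_finsetCard F
    _ ≤ _ := by exact_mod_cast hcard

/-! ### The trace and its holes -/

theorem mem_trace_of_step {s : ℕ → ℤ × ℤ} {n k : ℕ} {e : ℤ × ℤ} (hk : k + 1 ≤ 2 * n)
    (he : s (k + 1) = s k + e) {τ : ℝ} (h0 : 0 ≤ τ) (h1 : τ ≤ 1) {w : ℂ}
    (hre : w.re = (s k).1 + τ * e.1) (him : w.im = (s k).2 + τ * e.2) :
    w ∈ trace s 0 (2 * n) := by
  have hk' : (k : ℝ) + 1 ≤ 2 * n := by exact_mod_cast hk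
  have hk0 : (0 : ℝ) ≤ k := Nat.cast_nonneg k
  refine ⟨k + τ, ⟨by positivity, by linarith⟩, ?_⟩
  rcases h1.lt_or_eq with h1 | rfl
  · have hfl : ⌊(k : ℝ) + τ⌋₊ = k := by
      rw [Nat.floor_eq_iff (by positivity)]
      constructor <;> linarith
    apply Complex.ext
    · simp [interp, hfl, he, toPlane, hre]
    · simp [interp, hfl, he, toPlane, him]
  · have hfl : ⌊(k : ℝ) + 1⌋₊ = k + 1 := by exact_mod_cast Nat.floor_natCast (R := ℝ) (k + 1)
    apply Complex.ext
    · simp [interp, hfl, he, toPlane, hre]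
    · simp [interp, hfl, he, toPlane, him]

theorem mem_trace_iff {s : ℕ → ℤ × ℤ} {n : ℕ} {w : ℂ} : w ∈ trace s 0 (2 * n) ↔
    w = toPlane (s (2 * n)) ∨ ∃ k < 2 * n, ∃ τ ∈ Set.Icc (0 : ℝ) 1,
      w.re = (s k).1 + τ * (s (k + 1) - s k).1 ∧ w.im = (s k).2 + τ * (s (k + 1) - s k).2 := by
  constructor
  · rintro ⟨t, ⟨h0, h1⟩, rfl⟩
    rcases h1.lt_or_eq with h1 | rfl
    · refine Or.inr ⟨⌊t⌋₊, ?_, t - ⌊t⌋₊, ⟨?_, ?_⟩, ?_, ?_⟩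
      · rw [Nat.floor_lt h0]
        exact_mod_cast h1
      · exact sub_nonneg.2 (Nat.floor_le h0)
      · linarith [Nat.lt_floor_add_one t]
      · simp [interp, toPlane]
      · simp [interp, toPlane]
    · have hfl : ⌊(2 : ℝ) * n⌋₊ = 2 * n := by exact_mod_cast Nat.floor_natCast (R := ℝ) (2 * n)
      left
      simp [interp, hfl]
  · rintro (rfl | ⟨k, hk, τ, hτ, hre, him⟩)
    · have hfl : ⌊(2 : ℝ) * n⌋₊ = 2 * n := by exact_mod_cast Nat.floor_natCast (R := ℝ) (2 * n)
      refine ⟨2 * n, ⟨by positivity, le_rfl⟩, ?_⟩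
      simp [interp, hfl]
    · exact mem_trace_of_step hk (add_sub_cancel _ _).symm hτ.1 hτ.2 hre him

theorem isClosed_trace (s : ℕ → ℤ × ℤ) (n : ℕ) : IsClosed (trace s 0 (2 * n)) := by
  have : trace s 0 (2 * n) = {toPlane (s (2 * n))} ∪ ⋃ k ∈ Finset.range (2 * n),
      (fun τ : ℝ => (⟨(s k).1 + τ * (s (k + 1) - s k).1, (s k).2 + τ * (s (k + 1) - s k).2⟩ : ℂ)) ''
        Set.Icc 0 1 := by
    ext w
    rw [mem_trace_iff]
    simp only [Set.mem_union, Set.mem_singleton_iff, Set.mem_iUnion, Finset.mem_range,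
      Set.mem_image, exists_prop, Complex.ext_iff, eq_comm (a := w.re), eq_comm (a := w.im)]
  rw [this]
  refine isClosed_singleton.union (isClosed_biUnion_finset fun k _ => IsCompact.isClosed ?_)
  refine isCompact_Icc.image ?_
  have : (fun τ : ℝ => (⟨(s k).1 + τ * (s (k + 1) - s k).1,
      (s k).2 + τ * (s (k + 1) - s k).2⟩ : ℂ)) = fun τ : ℝ =>
      Complex.equivRealProdCLM.symm ((s k).1 + τ * (s (k + 1) - s k).1,
      (s k).2 + τ * (s (k + 1) - s k).2) := rfl
  rw [this]
  fun_prop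

theorem mem_trace_cases {s : ℕ → ℤ × ℤ} (hs : ∀ k, s (k + 1) - s k ∈ unitSteps) {n : ℕ} {w : ℂ}
    (hw : w ∈ trace s 0 (2 * n)) : (∃ k ≤ 2 * n, w = toPlane (s k)) ∨
      ∃ k < 2 * n, ∃ τ ∈ Set.Icc (0 : ℝ) 1, ∃ e ∈ unitSteps, s (k + 1) = s k + e ∧
      w.re = (s k).1 + τ * e.1 ∧ w.im = (s k).2 + τ * e.2 := by
  rcases mem_trace_iff.1 hw with h | ⟨k, hk, τ, hτ, h⟩
  · exact Or.inl ⟨2 * n, le_rfl, h⟩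
  · exact Or.inr ⟨k, hk, τ, hτ, _, hs k, (add_sub_cancel _ _).symm, h⟩

/-- The trace is contained in the lines of the grid, and close to the visited points. -/
theorem trace_subset {s : ℕ → ℤ × ℤ} (hs : ∀ k, s (k + 1) - s k ∈ unitSteps) {n : ℕ} {w : ℂ}
    (hw : w ∈ trace s 0 (2 * n)) : ((∃ a : ℤ, w.re = a) ∨ ∃ a : ℤ, w.im = a) ∧
      ∃ k ≤ 2 * n, |w.re - (s k).1| ≤ 1 ∧ |w.im - (s k).2| ≤ 1 := by
  rcases mem_trace_cases hs hw with ⟨k, hk, rfl⟩ | ⟨k, hk, τ, ⟨h0, h1⟩, e, he, -, hre, him⟩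
  · exact ⟨Or.inl ⟨(s k).1, rfl⟩, k, hk, by simp [toPlane], by simp [toPlane]⟩
  · simp only [unitSteps, Finset.mem_insert, Finset.mem_singleton] at he
    refine ⟨?_, k, hk.le, ?_⟩
    · rcases he with rfl | rfl | rfl | rfl
      · exact Or.inr ⟨(s k).2, by simpa using him⟩
      · exact Or.inr ⟨(s k).2, by simpa using him⟩
      · exact Or.inl ⟨(s k).1, by simpa using hre⟩
      · exact Or.inl ⟨(s k).1, by simpa using hre⟩
    · rcases he with rfl | rfl | rfl | rfl <;> simp [hre, him, abs_of_nonneg h0, h1]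

/-- The open unit square with lower left corner `(a, b)`. -/
def face (a b : ℤ) : Set ℂ := {w | (a < w.re ∧ w.re < a + 1) ∧ b < w.im ∧ w.im < b + 1}

theorem convex_face (a b : ℤ) : Convex ℝ (face a b) :=
  (((convex_halfSpace_re_gt _).inter (convex_halfSpace_re_lt _)).inter
    ((convex_halfSpace_im_gt _).inter (convex_halfSpace_im_lt _)))

theorem face_subset {s : ℕ → ℤ × ℤ} (hs : ∀ k, s (k + 1) - s k ∈ unitSteps) (n : ℕ) (a b : ℤ) :
    face a b ⊆ (trace s 0 (2 * n))ᶜ := by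
  rintro w ⟨⟨h1, h2⟩, h3, h4⟩ hw
  rcases (trace_subset hs hw).1 with ⟨c, hc⟩ | ⟨c, hc⟩
  · rw [hc] at h1 h2
    norm_cast at h1 h2
    omega
  · rw [hc] at h3 h4
    norm_cast at h3 h4
    omega

/-- Points off the lines of the grid are dense. -/
theorem exists_mem_face {V : Set ℂ} (hV : IsOpen V) (hne : V.Nonempty) :
    ∃ v ∈ V, v ∈ face ⌊v.re⌋ ⌊v.im⌋ := by
  have hd : Dense (Set.range ((↑) : ℤ → ℝ))ᶜ := (Set.countable_range _).dense_compl ℝ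
  have hd2 := (hd.prod hd).preimage Complex.equivRealProdCLM.toHomeomorph.isOpenMap
  obtain ⟨v, hv, hvV⟩ := hd2.exists_mem_open hV hne
  refine ⟨v, hvV, ⟨?_, Int.lt_floor_add_one _⟩, ?_, Int.lt_floor_add_one _⟩
  · exact lt_of_le_of_ne (Int.floor_le _) fun h => hv.1 ⟨_, h⟩
  · exact lt_of_le_of_ne (Int.floor_le _) fun h => hv.2 ⟨_, h⟩

/-- Each hole contains a face of the grid within bounded distance of a visited point. -/
theorem exists_face_subset_of_mem_holes {s : ℕ → ℤ × ℤ}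
    (hs : ∀ k, s (k + 1) - s k ∈ unitSteps) {n : ℕ} {C : Set ℂ} (hC : C ∈ holes s n) :
    ∃ k ≤ 2 * n, ∃ a ∈ Finset.Icc (-3 : ℤ) 3, ∃ b ∈ Finset.Icc (-3 : ℤ) 3,
      ∀ w ∈ face ((s k).1 + a) ((s k).2 + b), C = connectedComponentIn (trace s 0 (2 * n))ᶜ w := by
  obtain ⟨z, hz, rfl⟩ := hC
  set U := (trace s 0 (2 * n))ᶜ with hU
  have hUo : IsOpen U := (isClosed_trace s n).isOpen_compl
  have hCo : IsOpen (connectedComponentIn U z) := hUo.connectedComponentIn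
  have hne : connectedComponentIn U z ≠ Set.univ := by
    intro h
    have hmem : toPlane (s (2 * n)) ∈ U :=
      connectedComponentIn_subset U z (h ▸ Set.mem_univ _)
    exact hmem (mem_trace_iff.2 (Or.inl rfl))
  obtain ⟨w, hw⟩ := nonempty_frontier_iff.2 ⟨⟨z, mem_connectedComponentIn hz⟩, hne⟩
  have hwU : w ∉ U := by
    intro hwU
    have hwo : IsOpen (connectedComponentIn U w) := hUo.connectedComponentIn
    obtain ⟨v, hvw, hvz⟩ := mem_closure_iff.1 hw.1 _ hwo (mem_connectedComponentIn hwU)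
    rw [hCo.frontier_eq] at hw
    apply hw.2
    rw [connectedComponentIn_eq hvz, ← connectedComponentIn_eq hvw]
    exact mem_connectedComponentIn hwU
  obtain ⟨-, k, hk, hk1, hk2⟩ := trace_subset hs (not_not.1 hwU)
  obtain ⟨v, ⟨hvw, hvz⟩, hvf⟩ := exists_mem_face (Metric.isOpen_ball.inter hCo)
    (mem_closure_iff.1 hw.1 _ Metric.isOpen_ball (Metric.mem_ball_self (x := w) one_pos))
  have hd : ‖v - w‖ < 1 := by simpa [dist_eq_norm] using hvw
  have hd1 := (Complex.abs_re_le_norm (v - w)).trans_lt hd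
  have hd2 := (Complex.abs_im_le_norm (v - w)).trans_lt hd
  rw [Complex.sub_re] at hd1
  rw [Complex.sub_im] at hd2
  have hfloor : ∀ (x y : ℝ) (c : ℤ), |x - y| < 1 → |y - c| ≤ 1 →
      ⌊x⌋ - c ∈ Finset.Icc (-3 : ℤ) 3 := by
    intro x y c hx hy
    rw [abs_lt] at hx
    rw [abs_le] at hy
    have h1 := Int.floor_le x
    have h2 := Int.lt_floor_add_one x
    rw [Finset.mem_Icc]
    constructor
    · have : ((-3 : ℤ) : ℝ) ≤ ((⌊x⌋ - c : ℤ) : ℝ) := by push_cast; linarith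
      exact_mod_cast this
    · have : ((⌊x⌋ - c : ℤ) : ℝ) ≤ ((3 : ℤ) : ℝ) := by push_cast; linarith
      exact_mod_cast this
  refine ⟨k, hk, _, hfloor _ _ _ hd1 hk1, _, hfloor _ _ _ hd2 hk2, fun u hu => ?_⟩
  rw [add_sub_cancel, add_sub_cancel] at hu
  have hsub := (convex_face ⌊v.re⌋ ⌊v.im⌋).isPreconnected.subset_connectedComponentIn hvf
    (face_subset hs n _ _)
  rw [connectedComponentIn_eq hvz, connectedComponentIn_eq (hsub hu)]

theorem holeCount_le {s : ℕ → ℤ × ℤ} (hs : ∀ k, s (k + 1) - s k ∈ unitSteps) (n : ℕ) (r : ℝ≥0) :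
    holeCount s n r ≤ ((49 * (2 * n + 1) : ℕ) : ℕ∞) := by
  set F : Finset (ℕ × ℤ × ℤ) :=
    Finset.range (2 * n + 1) ×ˢ Finset.Icc (-3 : ℤ) 3 ×ˢ Finset.Icc (-3 : ℤ) 3 with hF
  have hcard : F.card = 49 * (2 * n + 1) := by
    simp [hF, mul_comm]
  calc holeCount s n r ≤ ((fun p : ℕ × ℤ × ℤ => connectedComponentIn (trace s 0 (2 * n))ᶜ
        ⟨((s p.1).1 + p.2.1 : ℤ) + 1 / 2, ((s p.1).2 + p.2.2 : ℤ) + 1 / 2⟩) ''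
          (F : Set (ℕ × ℤ × ℤ))).encard := by
        refine Set.encard_le_encard ?_
        rintro C ⟨hC, -⟩
        obtain ⟨k, hk, a, ha, b, hb, h⟩ := exists_face_subset_of_mem_holes hs hC
        refine ⟨(k, a, b), ?_, (h _ ?_).symm⟩
        · simp only [hF, Finset.mem_coe, Finset.mem_product, Finset.mem_range]
          exact ⟨by omega, ha, hb⟩
        · simp only [face, Set.mem_ofPred_eq]
          refine ⟨⟨?_, ?_⟩, ?_, ?_⟩ <;> linarith
    _ ≤ (F : Set (ℕ × ℤ × ℤ)).encard := Set.encard_image_le _ _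
    _ = F.card := Set.encard_coe_eq_coe_finsetCard F
    _ = _ := by rw [hcard]

/-! ### The hole inside a ring -/

/-- The open square of side length `2` with centre `z`. -/
def centredSquare (z : ℤ × ℤ) : Set ℂ :=
  {w | (z.1 - 1 < w.re ∧ w.re < z.1 + 1) ∧ (z.2 - 1 < w.im ∧ w.im < z.2 + 1)}

theorem convex_centredSquare (z : ℤ × ℤ) : Convex ℝ (centredSquare z) :=
  (((convex_halfSpace_re_gt _).inter (convex_halfSpace_re_lt _)).inter
    ((convex_halfSpace_im_gt _).inter (convex_halfSpace_im_lt _)))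

theorem isOpen_centredSquare (z : ℤ × ℤ) : IsOpen (centredSquare z) :=
  ((isOpen_lt continuous_const Complex.continuous_re).inter
    (isOpen_lt Complex.continuous_re continuous_const)).inter
    ((isOpen_lt continuous_const Complex.continuous_im).inter
    (isOpen_lt Complex.continuous_im continuous_const))

theorem toPlane_mem_centredSquare {z v : ℤ × ℤ} : toPlane v ∈ centredSquare z ↔ v = z := by
  constructor
  · rintro ⟨⟨h1, h2⟩, h3, h4⟩
    simp only [toPlane] at h1 h2 h3 h4
    norm_cast at h1 h2 h3 h4
    exact Prod.ext (by omega) (by omega)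
  · rintro rfl
    simp [centredSquare, toPlane]

theorem one_le_volume_centredSquare (z : ℤ × ℤ) : 1 ≤ volume (centredSquare z) := by
  have h : centredSquare z = Complex.measurableEquivRealProd ⁻¹'
      (Set.Ioo ((z.1 : ℝ) - 1) (z.1 + 1) ×ˢ Set.Ioo ((z.2 : ℝ) - 1) (z.2 + 1)) := rfl
  rw [h, Complex.volume_preserving_equiv_real_prod.measure_preimage_equiv, Measure.volume_eq_prod,
    Measure.prod_prod, Real.volume_Ioo, Real.volume_Ioo, ← ENNReal.ofReal_mul (by linarith),
    ENNReal.one_le_ofReal]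
  ring_nf
  norm_num

/-- The path does not enter the square around an unvisited point. -/
theorem centredSquare_subset {s : ℕ → ℤ × ℤ} (hs : ∀ k, s (k + 1) - s k ∈ unitSteps) {n : ℕ}
    {z : ℤ × ℤ} (hz : z ∈ unvisited s n) : centredSquare z ⊆ (trace s 0 (2 * n))ᶜ := by
  intro w hw hwt
  rcases mem_trace_cases hs hwt with ⟨k, hk, rfl⟩ | ⟨k, hk, τ, ⟨h0, h1⟩, e, he, hse, hre, him⟩
  · exact hz k hk (toPlane_mem_centredSquare.1 hw)
  · obtain ⟨⟨w1, w2⟩, w3, w4⟩ := hw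
    have hz0 := hz k hk.le
    have hz1 := hz (k + 1) hk
    rw [hse] at hz1
    simp only [Ne, Prod.ext_iff, Prod.fst_add, Prod.snd_add] at hz0 hz1
    rw [hre] at w1 w2
    rw [him] at w3 w4
    -- On each of the four possible edges one coordinate is constant, hence equal to that of `z`,
    -- and the other one is squeezed between those of the end points.
    have hi : ∀ a b : ℤ, (a : ℝ) < b + 1 ↔ a ≤ b := fun a b => by
      rw [← Int.lt_add_one_iff]; norm_cast
    simp only [unitSteps, Finset.mem_insert, Finset.mem_singleton] at he
    rcases he with rfl | rfl | rfl | rfl <;>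
      simp only [Int.cast_one, Int.cast_zero, Int.cast_neg, mul_one, mul_zero, mul_neg, add_zero]
        at w1 w2 w3 w4 hz1
    · have a1 := (hi z.1 ((s k).1 + 1)).1 (by push_cast; linarith)
      have a2 := (hi (s k).1 z.1).1 (by linarith)
      have a3 := (hi z.2 (s k).2).1 (by linarith)
      have a4 := (hi (s k).2 z.2).1 w4
      omega
    · have a1 := (hi z.1 (s k).1).1 (by linarith)
      have a2 := (hi (s k).1 (z.1 + 1)).1 (by push_cast; linarith)
      have a3 := (hi z.2 (s k).2).1 (by linarith)
      have a4 := (hi (s k).2 z.2).1 w4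
      omega
    · have a1 := (hi z.2 ((s k).2 + 1)).1 (by push_cast; linarith)
      have a2 := (hi (s k).2 z.2).1 (by linarith)
      have a3 := (hi z.1 (s k).1).1 (by linarith)
      have a4 := (hi (s k).1 z.1).1 w2
      omega
    · have a1 := (hi z.2 (s k).2).1 (by linarith)
      have a2 := (hi (s k).2 (z.2 + 1)).1 (by push_cast; linarith)
      have a3 := (hi z.1 (s k).1).1 (by linarith)
      have a4 := (hi (s k).1 z.1).1 w2
      omega

theorem IsRingCentre.mem_trace {s : ℕ → ℤ × ℤ} {n : ℕ} {z : ℤ × ℤ} (h : IsRingCentre s n z)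
    {l : ℕ} (hl : l < 8) {τ : ℝ} (h0 : 0 ≤ τ) (h1 : τ ≤ 1) {w : ℂ}
    (hre : w.re = z.1 + (ringPos l).1 + τ * (ringStep l).1)
    (him : w.im = z.2 + (ringPos l).2 + τ * (ringStep l).2) : w ∈ trace s 0 (2 * n) := by
  obtain ⟨-, j, hj, hpos⟩ := h
  refine mem_trace_of_step (k := j + l) (e := ringStep l) (by omega) ?_ h0 h1 ?_ ?_
  · rw [add_assoc, hpos (l + 1) hl, hpos l hl.le, ringPos_succ, add_assoc]
  · rw [hpos l hl.le, hre, Prod.fst_add]; push_cast; rfl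
  · rw [hpos l hl.le, him, Prod.snd_add]; push_cast; rfl

/-- The boundary of the square around the centre of a ring is traversed. -/
theorem IsRingCentre.mem_trace_of_mem_closure {s : ℕ → ℤ × ℤ} {n : ℕ} {z : ℤ × ℤ}
    (h : IsRingCentre s n z) {w : ℂ} (hw : w ∈ closure (centredSquare z))
    (hw' : w ∉ centredSquare z) : w ∈ trace s 0 (2 * n) := by
  have hcl : closure (centredSquare z) ⊆
      {w | ((z.1 : ℝ) - 1 ≤ w.re ∧ w.re ≤ z.1 + 1) ∧ ((z.2 : ℝ) - 1 ≤ w.im ∧ w.im ≤ z.2 + 1)} := by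
    refine closure_minimal (fun w hw => ⟨⟨hw.1.1.le, hw.1.2.le⟩, hw.2.1.le, hw.2.2.le⟩) ?_
    exact ((isClosed_le continuous_const Complex.continuous_re).inter
      (isClosed_le Complex.continuous_re continuous_const)).inter
      ((isClosed_le continuous_const Complex.continuous_im).inter
      (isClosed_le Complex.continuous_im continuous_const))
  obtain ⟨⟨w1, w2⟩, w3, w4⟩ := hcl hw
  have p : ringPos 0 = (1, 1) ∧ ringPos 1 = (0, 1) ∧ ringPos 2 = (-1, 1) ∧ ringPos 3 = (-1, 0) ∧
      ringPos 4 = (-1, -1) ∧ ringPos 5 = (0, -1) ∧ ringPos 6 = (1, -1) ∧ ringPos 7 = (1, 0) := by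
    decide
  obtain ⟨p0, p1, p2, p3, p4, p5, p6, p7⟩ := p
  rcases w4.eq_or_lt with e4 | l4
  · rcases le_total (z.1 : ℝ) w.re with hc | hc
    · refine h.mem_trace (l := 0) (by norm_num) (τ := z.1 + 1 - w.re) ?_ ?_ ?_ ?_ <;>
        norm_num [p0, ringStep] <;> linarith
    · refine h.mem_trace (l := 1) (by norm_num) (τ := z.1 - w.re) ?_ ?_ ?_ ?_ <;>
        norm_num [p1, ringStep] <;> linarith
  rcases w1.eq_or_lt with e1 | l1
  · rcases le_total (z.2 : ℝ) w.im with hc | hc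
    · refine h.mem_trace (l := 2) (by norm_num) (τ := z.2 + 1 - w.im) ?_ ?_ ?_ ?_ <;>
        norm_num [p2, ringStep] <;> linarith
    · refine h.mem_trace (l := 3) (by norm_num) (τ := z.2 - w.im) ?_ ?_ ?_ ?_ <;>
        norm_num [p3, ringStep] <;> linarith
  rcases w3.eq_or_lt with e3 | l3
  · rcases le_total w.re (z.1 : ℝ) with hc | hc
    · refine h.mem_trace (l := 4) (by norm_num) (τ := w.re - (z.1 - 1)) ?_ ?_ ?_ ?_ <;>
        norm_num [p4, ringStep] <;> linarith
    · refine h.mem_trace (l := 5) (by norm_num) (τ := w.re - z.1) ?_ ?_ ?_ ?_ <;>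
        norm_num [p5, ringStep] <;> linarith
  rcases w2.eq_or_lt with e2 | l2
  · rcases le_total w.im (z.2 : ℝ) with hc | hc
    · refine h.mem_trace (l := 6) (by norm_num) (τ := w.im - (z.2 - 1)) ?_ ?_ ?_ ?_ <;>
        norm_num [p6, ringStep] <;> linarith
    · refine h.mem_trace (l := 7) (by norm_num) (τ := w.im - z.2) ?_ ?_ ?_ ?_ <;>
        norm_num [p7, ringStep] <;> linarith
  exact absurd ⟨⟨l1, l2⟩, l3, l4⟩ hw'

/-- The square around the centre of a ring is a hole. -/
theorem encard_isRingCentre_le_holeCount {s : ℕ → ℤ × ℤ}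
    (hs : ∀ k, s (k + 1) - s k ∈ unitSteps) (n : ℕ) :
    {z | IsRingCentre s n z}.encard ≤ holeCount s n 1 := by
  have hcomp : ∀ z, IsRingCentre s n z →
      connectedComponentIn (trace s 0 (2 * n))ᶜ (toPlane z) = centredSquare z := by
    intro z hz
    have hsq := centredSquare_subset hs hz.1
    have hzz : toPlane z ∈ centredSquare z := toPlane_mem_centredSquare.2 rfl
    refine Set.Subset.antisymm ?_
      ((convex_centredSquare z).isPreconnected.subset_connectedComponentIn hzz hsq)
    refine isPreconnected_connectedComponentIn.subset_of_closure_inter_subset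
      (isOpen_centredSquare z) ⟨_, mem_connectedComponentIn (hsq hzz), hzz⟩ fun w hw => ?_
    by_contra hw'
    exact connectedComponentIn_subset _ _ hw.2 (hz.mem_trace_of_mem_closure hw.1 hw')
  refine Set.encard_le_encard_of_injOn (f := centredSquare) ?_ ?_
  · intro z hz
    have hzz : toPlane z ∈ centredSquare z := toPlane_mem_centredSquare.2 rfl
    refine ⟨⟨toPlane z, centredSquare_subset hs hz.1 hzz, (hcomp z hz).symm⟩, ?_⟩
    exact one_le_volume_centredSquare z
  · intro z _ z' _ h
    refine toPlane_mem_centredSquare.1 (?_ : toPlane z ∈ centredSquare z')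
    rw [← h]
    exact toPlane_mem_centredSquare.2 rfl

/-! ### Expectations and logarithmic asymptotics -/

section Expectation

variable {Ω : Type*} [MeasurableSpace Ω] {P : Measure Ω} {X : ℕ → Ω → ℤ × ℤ}

/-- A lower bound for the probability that a given time starts a ring followed by an escape. -/
noncomputable def ringBound (n : ℕ) : ℝ :=
  (1 / 4) ^ 8 * (1 / (4 * (1 + Real.log (4 * (2 * n : ℕ) + 1)))) ^ 2

theorem IsSimpleRandomSteps.ae_walk (hX : IsSimpleRandomSteps P X) [IsProbabilityMeasure P] :
    ∀ᵐ ω ∂P, ∀ k, walk X ω (k + 1) - walk X ω k ∈ unitSteps := by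
  filter_upwards [hX.ae_mem] with ω hω k
  rw [walk, Finset.sum_range_succ, walk, add_sub_cancel_left]
  exact hω k

theorem IsSimpleRandomSteps.le_lintegral (hX : IsSimpleRandomSteps P X)
    [IsProbabilityMeasure P] (n : ℕ) {Y : Ω → ℕ∞}
    (hY : ∀ᵐ ω ∂P, {z | IsRingCentre (walk X ω) n z}.encard ≤ Y ω) :
    ENNReal.ofReal ((2 * n - 7 : ℕ) * ringBound n) ≤ ∫⁻ ω, (Y ω : ℝ≥0∞) ∂P := by
  classical
  have hmeas : ∀ j, MeasurableSet {ω | IsRing (1, 1) (2 * n) j fun i => X i ω} := fun j =>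
    hX.measurableSet (dependsOn_isRing _ _ _)
  calc ENNReal.ofReal ((2 * n - 7 : ℕ) * ringBound n)
      = ∑ j ∈ Finset.range (2 * n - 7), ENNReal.ofReal (ringBound n) := by
        rw [Finset.sum_const, Finset.card_range, nsmul_eq_mul,
          ENNReal.ofReal_mul (Nat.cast_nonneg _), ENNReal.ofReal_natCast]
    _ ≤ ∑ j ∈ Finset.range (2 * n - 7), P {ω | IsRing (1, 1) (2 * n) j fun i => X i ω} :=
        Finset.sum_le_sum fun j hj => hX.le_measure_isRing (1, 1) (by
          have := Finset.mem_range.1 hj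
          omega)
    _ = ∫⁻ ω, ∑ j ∈ Finset.range (2 * n - 7),
          {ω | IsRing (1, 1) (2 * n) j fun i => X i ω}.indicator 1 ω ∂P := by
        rw [lintegral_finsetSum _ fun j _ => measurable_one.indicator (hmeas j)]
        exact Finset.sum_congr rfl fun j _ => (lintegral_indicator_one (hmeas j)).symm
    _ ≤ ∫⁻ ω, (Y ω : ℝ≥0∞) ∂P := by
        refine lintegral_mono_ae ?_
        filter_upwards [hY] with ω hω
        have hle := ENat.toENNReal_le.2 ((card_isRing_le X ω n).trans hω)
        refine le_trans (le_of_eq ?_) hle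
        simp [Set.indicator_apply]

theorem lintegral_le_of_ae_le [IsProbabilityMeasure P] {Y : Ω → ℕ∞} {b : ℕ}
    (hY : ∀ᵐ ω ∂P, Y ω ≤ b) : ∫⁻ ω, (Y ω : ℝ≥0∞) ∂P ≤ b := by
  calc ∫⁻ ω, (Y ω : ℝ≥0∞) ∂P ≤ ∫⁻ _, (b : ℝ≥0∞) ∂P := by
        refine lintegral_mono_ae ?_
        filter_upwards [hY] with ω hω
        simpa using ENat.toENNReal_le.2 hω
    _ = b := by simp

end Expectation

theorem isLittleO_log_log : (fun n : ℕ => Real.log (1 + Real.log (8 * n + 1))) =o[atTop]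
    fun n : ℕ => Real.log (n : ℝ) := by
  have h8 : Tendsto (fun n : ℕ => 1 + Real.log (8 * (n : ℝ) + 1)) atTop atTop := by
    refine tendsto_atTop_add_const_left _ _ (Real.tendsto_log_atTop.comp ?_)
    exact tendsto_atTop_add_const_right _ _
      (tendsto_natCast_atTop_atTop.const_mul_atTop (by norm_num))
  refine (Real.isLittleO_log_id_atTop.comp_tendsto h8).trans_isBigO (IsBigO.of_bound 3 ?_)
  filter_upwards [eventually_ge_atTop 9] with n hn
  have hn' : (9 : ℝ) ≤ n := by exact_mod_cast hn
  have h1 : 1 ≤ Real.log n := by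
    rw [Real.le_log_iff_exp_le (by linarith)]
    linarith [Real.exp_one_lt_d9]
  have h2 : Real.log (8 * n + 1) ≤ 2 * Real.log n := by
    rw [← Real.log_rpow (by linarith)]
    refine Real.log_le_log (by linarith) ?_
    norm_num
    nlinarith
  have h0 : 0 ≤ Real.log (8 * n + 1) := Real.log_nonneg (by linarith)
  simp only [Function.comp, id, Real.norm_eq_abs]
  rw [abs_of_nonneg (by linarith), abs_of_nonneg (by linarith)]
  linarith

/-- Bounds of order `n / (log n) ^ 2` and `n` determine the exponent of growth. -/
theorem log_isEquivalent_of_bounds {E : ℕ → ℝ≥0∞} {K : ℕ} (hK : 0 < K)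
    (hlo : ∀ n, ENNReal.ofReal ((2 * n - 7 : ℕ) * ringBound n) ≤ E n)
    (hup : ∀ n, E n ≤ ((K * (2 * n + 1) : ℕ) : ℝ≥0∞)) :
    (fun n : ℕ => Real.log (E n).toReal) ~[atTop] fun n : ℕ => Real.log (n : ℝ) := by
  have hlog : Tendsto (fun n : ℕ => Real.log (n : ℝ)) atTop atTop :=
    Real.tendsto_log_atTop.comp tendsto_natCast_atTop_atTop
  have hK' : (1 : ℝ) ≤ K := by exact_mod_cast hK
  set c : ℝ := Real.log (3 * K) + Real.log (4 ^ 11) with hc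
  have hbound : (fun n : ℕ => Real.log (E n).toReal - Real.log n) =O[atTop]
      fun n : ℕ => c + 2 * Real.log (1 + Real.log (8 * n + 1)) := by
    refine IsBigO.of_bound 1 ?_
    filter_upwards [eventually_ge_atTop 4] with n hn
    have hn' : (4 : ℝ) ≤ n := by exact_mod_cast hn
    set ℓ := 1 + Real.log (8 * n + 1) with hℓ
    have hℓ1 : 1 ≤ ℓ := by
      have := Real.log_nonneg (show (1 : ℝ) ≤ 8 * n + 1 by linarith)
      linarith
    have hring : ringBound n = 1 / (4 ^ 10 * ℓ ^ 2) := by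
      have : (4 : ℝ) * (2 * n : ℕ) + 1 = 8 * n + 1 := by push_cast; ring
      rw [ringBound, this, ← hℓ, div_pow, div_pow, div_mul_div_comm]
      congr 1 <;> ring
    have hfin : E n ≠ ⊤ := ne_top_of_le_ne_top (ENNReal.natCast_ne_top _) (hup n)
    have hU : (E n).toReal ≤ 3 * K * n := by
      have := ENNReal.toReal_mono (ENNReal.natCast_ne_top _) (hup n)
      rw [ENNReal.toReal_natCast] at this
      push_cast at this
      nlinarith
    have hL : n / (4 ^ 11 * ℓ ^ 2) ≤ (E n).toReal := by
      refine le_trans ?_ ((ENNReal.ofReal_le_iff_le_toReal hfin).1 (hlo n))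
      have h7 : (n : ℝ) / 4 ≤ (2 * n - 7 : ℕ) := by
        rw [Nat.cast_sub (by omega)]
        push_cast
        linarith
      rw [hring]
      calc (n : ℝ) / (4 ^ 11 * ℓ ^ 2) = n / 4 * (1 / (4 ^ 10 * ℓ ^ 2)) := by
            field_simp
        _ ≤ _ := mul_le_mul_of_nonneg_right h7 (by positivity)
    have hLpos : 0 < (n : ℝ) / (4 ^ 11 * ℓ ^ 2) := by positivity
    have h1 := Real.log_le_log hLpos hL
    have h2 := Real.log_le_log (hLpos.trans_le hL) hU
    rw [Real.log_div (by positivity) (by positivity), Real.log_mul (by positivity) (by positivity),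
      Real.log_pow ℓ] at h1
    rw [Real.log_mul (by positivity) (by positivity)] at h2
    have h3 : 0 ≤ Real.log (3 * K) := Real.log_nonneg (by linarith)
    have h4 : 0 ≤ Real.log ((4 : ℝ) ^ 11) := Real.log_nonneg (by norm_num)
    have h5 := Real.log_nonneg hℓ1
    push_cast at h1
    rw [one_mul, Real.norm_eq_abs, Real.norm_eq_abs,
      abs_of_nonneg (show 0 ≤ c + 2 * Real.log ℓ by linarith), abs_le]
    constructor <;> linarith
  refine hbound.trans_isLittleO (IsLittleO.add ?_ (isLittleO_log_log.const_mul_left 2))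
  exact isLittleO_const_left.2 (Or.inr (tendsto_norm_atTop_atTop.comp hlog))

end PlanarWalk

theorem corollary6p1 {Ω : Type*} [MeasurableSpace Ω] (P : Measure Ω) [IsProbabilityMeasure P]
    (X : ℕ → Ω → ℤ × ℤ) (hX : PlanarWalk.IsSimpleRandomSteps P X) :
    ((fun n : ℕ => Real.log (PlanarWalk.expectedHoles P X n 1).toReal)
        ~[atTop] fun n : ℕ => Real.log (n : ℝ)) ∧
      ((fun n : ℕ => Real.log (PlanarWalk.expectedLatticeHoles P X n 1).toReal)
        ~[atTop] fun n : ℕ => Real.log (n : ℝ)) := by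
  constructor
  · refine PlanarWalk.log_isEquivalent_of_bounds (K := 49) (by norm_num) (fun n => ?_) fun n => ?_
    · refine hX.le_lintegral n ?_
      filter_upwards [hX.ae_walk] with ω hω
      exact PlanarWalk.encard_isRingCentre_le_holeCount hω n
    · refine PlanarWalk.lintegral_le_of_ae_le ?_
      filter_upwards [hX.ae_walk] with ω hω
      exact PlanarWalk.holeCount_le hω n 1
  · refine PlanarWalk.log_isEquivalent_of_bounds (K := 4) (by norm_num) (fun n => ?_) fun n => ?_
    · exact hX.le_lintegral n
        (ae_of_all _ fun ω => PlanarWalk.encard_isRingCentre_le_latticeHoleCount _ n)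
    · exact PlanarWalk.lintegral_le_of_ae_le
        (ae_of_all _ fun ω => PlanarWalk.latticeHoleCount_le _ n 1)
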